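/- Consider three parties, Alice, Bob and Charlie. Alice has settings $x\in\{1,2,3\}$ and outcomes $a\in\{1,-1\}$, Bob has a single measurement with outcomes $b=b_1b_2\in\{0,1\}^2$, and Charlie has settings $z\in\{1,\dots,6\}$ and outcomes $c\in\{1,-1\}$. Let $P(a,b,c|x,z)$ be a family of probability distributions (one for each pair $(x,z)$) whose Bob marginal $P(b)=\sum_{a,c}P(a,b,c|x,z)$ does not depend on $x,z$. Put $S^b_{xz}=\sum_{a,c=\pm1}P(a,b,c|x,z)\,ac$ and $$\begin{aligned}\mathscr T_b(P)={}&(-1)^{b_2}(S^b_{11}+S^b_{12})+(-1)^{b_1}(S^b_{21}-S^b_{22})+(-1)^{b_2}(S^b_{13}+S^b_{14})\\&-(-1)^{b_1+b_2}(S^b_{33}-S^b_{34})+(-1)^{b_1}(S^b_{25}+S^b_{26})-(-1)^{b_1+b_2}(S^b_{35}-S^b_{36}).\end{aligned}$$ Let $\varepsilon_c=7.18\cdot10^{-5}$ and suppose that, for every $b\in\{0,1\}^2$, $$\left|P(b)-\tfrac14\right|<\varepsilon_c\qquad\text{and}\qquad \mathscr T_b(P)>(6\sqrt2-\varepsilon_c)\,P(b).$$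 Then $P$ has no real quantum representation in any dimension. That is, there are no real Hilbert spaces $A,B_1,B_2,C$ (of finite or infinite dimension), discrete probability distribution $p(\lambda)$, real quantum states (positive operators of trace one) $\sigma^\lambda_{AB_1}$ on $A\otimes B_1$ and $\tau^\lambda_{B_2C}$ on $B_2\otimes C$, and real projective measurements $\{A_{a|x}\}_a$ on $A$, $\{B_b\}_b$ on $B_1\otimes B_2$, $\{C_{c|z}\}_c$ on $C$ (orthogonal projections summing to the identity) such that, for all $a,b,c,x,z$, $$P(a,b,c|x,z)=\sum_\lambda p(\lambda)\,\mathrm{tr}\!\left[(\sigma^\lambda_{AB_1}\otimes\tau^\lambda_{B_2C})(A_{a|x}\otimes B_b\otimes C_{c|z})\right].$$ -/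

import Mathlib

open scoped TensorProduct InnerProductSpace

universe u₀ u₁ u₂ u₃ u₄

noncomputable section

namespace RealSwap

/-! ### Hilbert tensor product of real Hilbert spaces -/

section Tensor

variable (H K H' K' : Type*)
  [NormedAddCommGroup H] [InnerProductSpace ℝ H]
  [NormedAddCommGroup K] [InnerProductSpace ℝ K]
  [NormedAddCommGroup H'] [InnerProductSpace ℝ H']
  [NormedAddCommGroup K'] [InnerProductSpace ℝ K']

/-- The Hilbert space tensor product: the completion of the algebraic tensor product for the inner
product with `⟪x ⊗ y, x' ⊗ y'⟫ = ⟪x, x'⟫ * ⟪y, y'⟫`. -/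
def HTensor : Type _ := UniformSpace.Completion (H ⊗[ℝ] K)

instance : NormedAddCommGroup (HTensor H K) :=
  inferInstanceAs (NormedAddCommGroup (UniformSpace.Completion (H ⊗[ℝ] K)))

instance : InnerProductSpace ℝ (HTensor H K) :=
  inferInstanceAs (InnerProductSpace ℝ (UniformSpace.Completion (H ⊗[ℝ] K)))

instance : CompleteSpace (HTensor H K) :=
  inferInstanceAs (CompleteSpace (UniformSpace.Completion (H ⊗[ℝ] K)))

/-- The inclusion of the algebraic tensor product in its completion. -/
def incl : H ⊗[ℝ] K →ₗᵢ[ℝ] HTensor H K :=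
  (UniformSpace.Completion.toComplₗᵢ : H ⊗[ℝ] K →ₗᵢ[ℝ] UniformSpace.Completion (H ⊗[ℝ] K))

theorem denseRange_incl : DenseRange (incl H K) :=
  UniformSpace.Completion.denseRange_coe (α := H ⊗[ℝ] K)

variable {H K H' K'}

/-- The elementary tensor `x ⊗ y` in the Hilbert tensor product. -/
def tmk (x : H) (y : K) : HTensor H K := incl H K (x ⊗ₜ y)

theorem inner_tmk (x x' : H) (y y' : K) :
    ⟪tmk x y, tmk x' y'⟫_ℝ = ⟪x, x'⟫_ℝ * ⟪y, y'⟫_ℝ := by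
  rw [tmk, tmk, LinearIsometry.inner_map_map, TensorProduct.inner_tmul]

/-- The tensor product `S ⊗ T` of two bounded operators. -/
def opTensor (S : H →L[ℝ] H') (T : K →L[ℝ] K') : HTensor H K →L[ℝ] HTensor H' K' :=
  ((TensorProduct.mapL S T).completion :
    UniformSpace.Completion (H ⊗[ℝ] K) →L[ℝ] UniformSpace.Completion (H' ⊗[ℝ] K'))

theorem opTensor_tmk (S : H →L[ℝ] H') (T : K →L[ℝ] K') (x : H) (y : K) :
    opTensor S T (tmk x y) = tmk (S x) (T y) :=
  (TensorProduct.mapL S T).completion_apply_coe (x ⊗ₜ y)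

/-- The algebraic tensor product of two isometries with dense range has dense range. -/
theorem denseRange_tensor (f : H →ₗᵢ[ℝ] H') (g : K →ₗᵢ[ℝ] K') (hf : DenseRange f)
    (hg : DenseRange g) : DenseRange (TensorProduct.mapIsometry f g) := by
  have key : ∀ z : H' ⊗[ℝ] K', z ∈ closure (Set.range (TensorProduct.mapIsometry f g)) := by
    intro z
    have hcl : closure (Set.range (TensorProduct.mapIsometry f g)) =
        ((LinearMap.range (TensorProduct.mapIsometry f g).toLinearMap).topologicalClosure :
          Set (H' ⊗[ℝ] K')) := by
      rw [Submodule.topologicalClosure_coe]; rfl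
    rw [hcl]
    induction z using TensorProduct.induction_on with
    | zero => exact Submodule.zero_mem _
    | add a b ha hb => exact Submodule.add_mem _ ha hb
    | tmul x y =>
      rw [← hcl]
      have h1 : (x, y) ∈ closure (Set.range (Prod.map f g)) := (hf.prodMap hg) (x, y)
      have h2 := map_mem_closure (t := Set.range (TensorProduct.mapIsometry f g))
        (TensorProduct.continuous_tmul (𝕜 := ℝ) (E := H') (F := K')) h1 (by
          rintro _ ⟨⟨a, b⟩, rfl⟩
          exact ⟨a ⊗ₜ b, by simp⟩)
      exact h2
  exact key

end Tensor

/-! ### Regrouping subsystems -/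

section Regroup

variable {H K H' K' : Type*}
  [NormedAddCommGroup H] [InnerProductSpace ℝ H]
  [NormedAddCommGroup K] [InnerProductSpace ℝ K]
  [NormedAddCommGroup H'] [InnerProductSpace ℝ H']
  [NormedAddCommGroup K'] [InnerProductSpace ℝ K']

/-- The tensor product of two unitaries, as a unitary. -/
def tensorCongr (f : H ≃ₗᵢ[ℝ] H') (g : K ≃ₗᵢ[ℝ] K') : HTensor H K ≃ₗᵢ[ℝ] HTensor H' K' :=
  LinearEquiv.extendOfIsometry (TensorProduct.congrIsometry f g).toLinearEquiv
    (incl H K).toLinearMap (incl H' K').toLinearMap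
    (denseRange_incl H K) (denseRange_incl H' K')
    (fun x => (LinearIsometry.norm_map _ _).trans
      (((TensorProduct.congrIsometry f g).norm_map x).trans (LinearIsometry.norm_map _ x).symm))

theorem tensorCongr_tmk (f : H ≃ₗᵢ[ℝ] H') (g : K ≃ₗᵢ[ℝ] K') (x : H) (y : K) :
    tensorCongr f g (tmk x y) = tmk (f x) (g y) :=
  LinearEquiv.extendOfIsometry_eq (TensorProduct.congrIsometry f g).toLinearEquiv
    (incl H K).toLinearMap (incl H' K').toLinearMap
    _ _ _ (x ⊗ₜ y)

/-- The operator `U⁻¹ T U` obtained from `T` through the unitary `U`. -/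
def pullback (U : H ≃ₗᵢ[ℝ] K) (T : K →L[ℝ] K) : H →L[ℝ] H :=
  U.symm.toContinuousLinearEquiv.toContinuousLinearMap ∘L T ∘L
    U.toContinuousLinearEquiv.toContinuousLinearMap

theorem pullback_apply (U : H ≃ₗᵢ[ℝ] K) (T : K →L[ℝ] K) (x : H) :
    pullback U T x = U.symm (T (U x)) := rfl

end Regroup

section Assoc

variable (H K L : Type*)
  [NormedAddCommGroup H] [InnerProductSpace ℝ H]
  [NormedAddCommGroup K] [InnerProductSpace ℝ K]
  [NormedAddCommGroup L] [InnerProductSpace ℝ L]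

/-- Inclusion of the algebraic `(H ⊗ K) ⊗ L` in its Hilbert space version. -/
def inclLeft : (H ⊗[ℝ] K) ⊗[ℝ] L →ₗᵢ[ℝ] HTensor (HTensor H K) L :=
  (incl (HTensor H K) L).comp (TensorProduct.mapIsometry (incl H K) LinearIsometry.id)

/-- Inclusion of the algebraic `H ⊗ (K ⊗ L)` in its Hilbert space version. -/
def inclRight : H ⊗[ℝ] (K ⊗[ℝ] L) →ₗᵢ[ℝ] HTensor H (HTensor K L) :=
  (incl H (HTensor K L)).comp (TensorProduct.mapIsometry LinearIsometry.id (incl K L))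

theorem denseRange_inclLeft : DenseRange (inclLeft H K L) := by
  have h := denseRange_tensor (incl H K) (LinearIsometry.id : L →ₗᵢ[ℝ] L)
    (denseRange_incl H K) Function.surjective_id.denseRange
  exact (denseRange_incl (HTensor H K) L).comp h (incl (HTensor H K) L).continuous

theorem denseRange_inclRight : DenseRange (inclRight H K L) := by
  have h := denseRange_tensor (LinearIsometry.id : H →ₗᵢ[ℝ] H) (incl K L)
    Function.surjective_id.denseRange (denseRange_incl K L)
  exact (denseRange_incl H (HTensor K L)).comp h (incl H (HTensor K L)).continuous

/-- The canonical unitary `(H ⊗ K) ⊗ L ≅ H ⊗ (K ⊗ L)`. -/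
def tensorAssoc : HTensor (HTensor H K) L ≃ₗᵢ[ℝ] HTensor H (HTensor K L) :=
  LinearEquiv.extendOfIsometry (TensorProduct.assocIsometry ℝ H K L).toLinearEquiv
    (inclLeft H K L).toLinearMap (inclRight H K L).toLinearMap
    (denseRange_inclLeft H K L) (denseRange_inclRight H K L)
    (fun x => ((inclRight H K L).norm_map _).trans
      (((TensorProduct.assocIsometry ℝ H K L).norm_map x).trans
        ((inclLeft H K L).norm_map x).symm))

theorem tensorAssoc_tmk (x : H) (y : K) (z : L) :
    tensorAssoc H K L (tmk (tmk x y) z) = tmk x (tmk y z) :=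
  LinearEquiv.extendOfIsometry_eq (TensorProduct.assocIsometry ℝ H K L).toLinearEquiv
    (inclLeft H K L).toLinearMap (inclRight H K L).toLinearMap _ _ _ ((x ⊗ₜ y) ⊗ₜ z)

/-- The canonical unitary `(A ⊗ B₁) ⊗ (B₂ ⊗ C) ≅ A ⊗ ((B₁ ⊗ B₂) ⊗ C)`, from the grouping of the
subsystems according to sources to their grouping according to parties. -/
def shuffle (A B₁ B₂ C : Type*)
    [NormedAddCommGroup A] [InnerProductSpace ℝ A]
    [NormedAddCommGroup B₁] [InnerProductSpace ℝ B₁]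
    [NormedAddCommGroup B₂] [InnerProductSpace ℝ B₂]
    [NormedAddCommGroup C] [InnerProductSpace ℝ C] :
    HTensor (HTensor A B₁) (HTensor B₂ C) ≃ₗᵢ[ℝ] HTensor A (HTensor (HTensor B₁ B₂) C) :=
  (tensorAssoc A B₁ (HTensor B₂ C)).trans
    (tensorCongr (LinearIsometryEquiv.refl ℝ A) (tensorAssoc B₁ B₂ C).symm)

theorem shuffle_tmk {A B₁ B₂ C : Type*}
    [NormedAddCommGroup A] [InnerProductSpace ℝ A]
    [NormedAddCommGroup B₁] [InnerProductSpace ℝ B₁]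
    [NormedAddCommGroup B₂] [InnerProductSpace ℝ B₂]
    [NormedAddCommGroup C] [InnerProductSpace ℝ C]
    (a : A) (b₁ : B₁) (b₂ : B₂) (c : C) :
    shuffle A B₁ B₂ C (tmk (tmk a b₁) (tmk b₂ c)) = tmk a (tmk (tmk b₁ b₂) c) := by
  have h : (tensorAssoc B₁ B₂ C).symm (tmk b₁ (tmk b₂ c)) = tmk (tmk b₁ b₂) c := by
    rw [LinearIsometryEquiv.symm_apply_eq, tensorAssoc_tmk]
  simp [shuffle, tensorAssoc_tmk, tensorCongr_tmk, h]

end Assoc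

/-! ### States and measurements -/

section States

variable {H : Type*} [NormedAddCommGroup H] [InnerProductSpace ℝ H]

/-- `T` has trace `t`: in every orthonormal Hilbert basis the diagonal of `T` sums (unconditionally)
to `t`. Every trace class operator has a trace in this sense. -/
def HasTrace (T : H →L[ℝ] H) (t : ℝ) : Prop :=
  ∀ (s : Set H) (e : HilbertBasis s ℝ H), HasSum (fun i => ⟪e i, T (e i)⟫_ℝ) t

/-- Quantum states: (self-adjoint) positive operators of trace one. -/
structure IsState (ρ : H →L[ℝ] H) : Prop where
  isPositive : ρ.IsPositive
  hasTrace : HasTrace ρ 1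

/-- Projective measurements: families of orthogonal projections adding up to the identity. -/
structure IsProjectiveMeasurement [CompleteSpace H] {O : Type*} [Fintype O]
    (M : O → H →L[ℝ] H) : Prop where
  isProjection : ∀ o, IsStarProjection (M o)
  sum_eq_one : ∑ o, M o = 1

end States

/-! ### The scenario -/

/-- Families `P a b c x z = P(a,b,c|x,z)`, with outcomes `a, c ∈ {1, -1}`, `b = (b₁, b₂) ∈ {0,1}²`
and settings `x`, `z`, numbered here from `0`: `x = 0, 1, 2` and `z = 0, …, 5`. -/
abbrev Family : Type := ℤˣ → Fin 2 × Fin 2 → ℤˣ → Fin 3 → Fin 6 → ℝ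

/-- `P(·|x,z)` is a probability distribution for all settings. -/
structure IsDistribution (P : Family) : Prop where
  nonneg : ∀ a b c x z, 0 ≤ P a b c x z
  sum_eq_one : ∀ x z, ∑ a, ∑ b, ∑ c, P a b c x z = 1

/-- `p` is the distribution `P(b)` of the outcome of Bob, which does not depend on `x` and `z`. -/
def IsBobMarginal (P : Family) (p : Fin 2 × Fin 2 → ℝ) : Prop :=
  ∀ b x z, ∑ a, ∑ c, P a b c x z = p b

/-- The (unnormalised) correlators `S^b_{xz} = ∑_{a,c} P(a,b,c|x,z) a c`. -/
def corr (P : Family) (b : Fin 2 × Fin 2) (x : Fin 3) (z : Fin 6) : ℝ :=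
  ∑ a : ℤˣ, ∑ c : ℤˣ, P a b c x z * ((a : ℤ) : ℝ) * ((c : ℤ) : ℝ)

/-- The functional `𝒯_b`, the combination of three CHSH expressions with signs depending on `b`
(recall that settings are numbered from `0`). -/
def chshThree (P : Family) (b : Fin 2 × Fin 2) : ℝ :=
  (-1) ^ (b.2 : ℕ) * (corr P b 0 0 + corr P b 0 1)
    + (-1) ^ (b.1 : ℕ) * (corr P b 1 0 - corr P b 1 1)
    + (-1) ^ (b.2 : ℕ) * (corr P b 0 2 + corr P b 0 3)
    - (-1) ^ ((b.1 : ℕ) + (b.2 : ℕ)) * (corr P b 2 2 - corr P b 2 3)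
    + (-1) ^ (b.1 : ℕ) * (corr P b 1 4 + corr P b 1 5)
    - (-1) ^ ((b.1 : ℕ) + (b.2 : ℕ)) * (corr P b 2 4 - corr P b 2 5)

/-- A real quantum model of the scenario on real Hilbert spaces `A, B₁, B₂, C` of any dimension:
shared randomness with distribution `p` on `Λ`, states `σ l` of `A ⊗ B₁` and `τ l` of `B₂ ⊗ C`
prepared by the two sources, and projective measurements of the three parties. -/
structure Model (Λ A B₁ B₂ C : Type*)
    [NormedAddCommGroup A] [InnerProductSpace ℝ A] [CompleteSpace A]
    [NormedAddCommGroup B₁] [InnerProductSpace ℝ B₁]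
    [NormedAddCommGroup B₂] [InnerProductSpace ℝ B₂]
    [NormedAddCommGroup C] [InnerProductSpace ℝ C] [CompleteSpace C] where
  p : Λ → ℝ
  p_nonneg : ∀ l, 0 ≤ p l
  p_sum : HasSum p 1
  σ : Λ → HTensor A B₁ →L[ℝ] HTensor A B₁
  σ_state : ∀ l, IsState (σ l)
  τ : Λ → HTensor B₂ C →L[ℝ] HTensor B₂ C
  τ_state : ∀ l, IsState (τ l)
  alice : Fin 3 → ℤˣ → A →L[ℝ] A
  alice_meas : ∀ x, IsProjectiveMeasurement (alice x)
  bob : Fin 2 × Fin 2 → HTensor B₁ B₂ →L[ℝ] HTensor B₁ B₂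
  bob_meas : IsProjectiveMeasurement bob
  charlie : Fin 6 → ℤˣ → C →L[ℝ] C
  charlie_meas : ∀ z, IsProjectiveMeasurement (charlie z)

namespace Model

variable {Λ A B₁ B₂ C : Type*}
  [NormedAddCommGroup A] [InnerProductSpace ℝ A] [CompleteSpace A]
  [NormedAddCommGroup B₁] [InnerProductSpace ℝ B₁]
  [NormedAddCommGroup B₂] [InnerProductSpace ℝ B₂]
  [NormedAddCommGroup C] [InnerProductSpace ℝ C] [CompleteSpace C]

/-- The global state `σ l ⊗ τ l`. -/
def globalState (M : Model Λ A B₁ B₂ C) (l : Λ) :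
    HTensor (HTensor A B₁) (HTensor B₂ C) →L[ℝ] HTensor (HTensor A B₁) (HTensor B₂ C) :=
  opTensor (M.σ l) (M.τ l)

/-- The joint measurement operator `A_{a|x} ⊗ B_b ⊗ C_{c|z}`, as an operator on
`(A ⊗ B₁) ⊗ (B₂ ⊗ C)`. -/
def globalEffect (M : Model Λ A B₁ B₂ C) (a : ℤˣ) (b : Fin 2 × Fin 2) (c : ℤˣ)
    (x : Fin 3) (z : Fin 6) :
    HTensor (HTensor A B₁) (HTensor B₂ C) →L[ℝ] HTensor (HTensor A B₁) (HTensor B₂ C) :=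
  pullback (shuffle A B₁ B₂ C) (opTensor (M.alice x a) (opTensor (M.bob b) (M.charlie z c)))

/-- The model reproduces `P`:
`P(a,b,c|x,z) = ∑_l p(l) tr((σ l ⊗ τ l) (A_{a|x} ⊗ B_b ⊗ C_{c|z}))`. -/
def Reproduces (M : Model Λ A B₁ B₂ C) (P : Family) : Prop :=
  ∀ a b c x z, ∃ t : Λ → ℝ,
    (∀ l, HasTrace (M.globalState l ∘L M.globalEffect a b c x z) (t l)) ∧
      HasSum (fun l => M.p l * t l) (P a b c x z)

end Model

/-- `P` admits a real quantum representation: it is reproduced by some model on some real Hilbert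
spaces, of arbitrary finite or infinite dimension. -/
def HasRealQuantumRepresentation (P : Family) : Prop :=
  ∃ (Λ : Type u₀)
    (A : Type u₁) (_ : NormedAddCommGroup A) (_ : InnerProductSpace ℝ A) (_ : CompleteSpace A)
    (B₁ : Type u₂) (_ : NormedAddCommGroup B₁) (_ : InnerProductSpace ℝ B₁) (_ : CompleteSpace B₁)
    (B₂ : Type u₃) (_ : NormedAddCommGroup B₂) (_ : InnerProductSpace ℝ B₂) (_ : CompleteSpace B₂)
    (C : Type u₄) (_ : NormedAddCommGroup C) (_ : InnerProductSpace ℝ C) (_ : CompleteSpace C)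
    (M : Model Λ A B₁ B₂ C), M.Reproduces P

/-- The critical error `7.18 · 10⁻⁵`. -/
def criticalError : ℝ := 7.18 / 10 ^ 5

end RealSwap

end

-- On a real Hilbert space a skew-adjoint operator has expectation zero in every vector, whereas a
-- violation close to `6√2` would give such an operator a large expectation.
--
-- Diagonalising both states (`IsState.exists_eigenbasis`) turns a model into a mixture of product
-- vectors `e ⊗ f`, and the functional is linear in `P`, so it suffices to bound `∑ b, 𝒯_b` on unit
-- product vectors. Let `ψ` be one, `b` an outcome of Bob and `φ = B_b ψ`. Once signs depending on
-- `b` are absorbed into Alice's observables, `𝒯_b` is a sum of three CHSH expressions, one for each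
-- pair among `A₀, A₁, A₂`. By the sum of squares for CHSH (`chsh_sum_of_squares`), a value close to
-- `6√2 ‖φ‖²` makes the `Aᵢ` act on `φ` nearly like operators `(C_k ± C_l)/√2` of Charlie, and the
-- two operators of each such pair anticommute. Hence the `Aᵢ` nearly anticommute on `φ`
-- (`norm_anticommutator_le`), and three exchanges nearly turn `A₀A₁A₂` into `-A₂A₁A₀`. If `T` is
-- the product of Charlie's substitutes for `A₀, A₁, A₂`, then `(A₀A₁A₂ - A₂A₁A₀) T` has expectation
-- nearly `2 ‖φ‖²` (`two_mul_norm_sq_sub_le_inner`).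
--
-- The three signs multiply to `-1` for every `b`. With `K` the difference of triple products of the
-- unsigned observables, the same operator `K ⊗ 1 ⊗ T` therefore serves all four outcomes, and
-- summation over `b` removes Bob's projections. On `ψ = e ⊗ f` its expectation factors as `⟪e, (K ⊗
-- 1) e⟫ ⟪f, (1 ⊗ T) f⟫`, which vanishes since `K` is skew (`inner_opTensor_aliceSkew`). What
-- remains is `1 ≤ 400√2 (6√2 - ∑ b, 𝒯_b)` (`norm_sq_le_of_product`).

universe u

namespace RealSwap

/-! ### Diagonalisation of states -/

section Spectral

variable {H : Type u} [NormedAddCommGroup H] [InnerProductSpace ℝ H]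

/-- Cauchy–Schwarz for the form of `T`: the polynomial `t ↦ ⟪tx + y, T (tx + y)⟫` is nonnegative, so
its discriminant is at most zero. -/
theorem inner_sq_le_of_isPositive {T : H →L[ℝ] H} (hT : T.IsPositive) (x y : H) :
    ⟪x, T y⟫_ℝ ^ 2 ≤ ⟪x, T x⟫_ℝ * ⟪y, T y⟫_ℝ := by
  have hsymm : ⟪y, T x⟫_ℝ = ⟪x, T y⟫_ℝ := by
    rw [real_inner_comm, hT.inner_left_eq_inner_right]
  have h : ∀ t : ℝ, 0 ≤ ⟪x, T x⟫_ℝ * (t * t) + 2 * ⟪x, T y⟫_ℝ * t + ⟪y, T y⟫_ℝ := by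
    intro t
    have h0 := hT.inner_nonneg_right (t • x + y)
    simp only [map_add, map_smul, inner_add_left, inner_add_right, real_inner_smul_left,
      real_inner_smul_right, hsymm] at h0
    linarith
  have hd := discrim_le_zero h
  rw [discrim] at hd
  nlinarith

theorem hasSum_inner_sq {ι : Type*} (b : HilbertBasis ι ℝ H) (x : H) :
    HasSum (fun i => ⟪b i, x⟫_ℝ ^ 2) (‖x‖ ^ 2) := by
  have h := b.hasSum_inner_mul_inner x x
  rw [real_inner_self_eq_norm_sq] at h
  simpa only [real_inner_comm x, ← sq] using h

/-- A positive operator whose diagonal is summable in some Hilbert basis is compact. -/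
theorem isCompactOperator_of_summable_diagonal {T : H →L[ℝ] H}
    (hT : T.IsPositive) {ι : Type*} (b : HilbertBasis ι ℝ H)
    (hs : Summable fun i => ⟪b i, T (b i)⟫_ℝ) [CompleteSpace H] : IsCompactOperator T := by
  classical
  -- Orthogonal projections onto finitely many basis vectors. The finite-rank operators `Q F ∘L T`
  -- converge to `T` in norm, the error being controlled by the tail of the trace.
  let Q : Finset ι → H →L[ℝ] H := fun F => ∑ i ∈ F, (innerSL ℝ (b i)).smulRight (b i)
  have hQ : ∀ F x, Q F x = ∑ i ∈ F, ⟪b i, x⟫_ℝ • b i := by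
    intro F x; simp [Q]
  have hcoef : ∀ F x j, ⟪b j, x - Q F x⟫_ℝ = if j ∈ F then 0 else ⟪b j, x⟫_ℝ := by
    intro F x j
    rw [inner_sub_right, hQ, inner_sum]
    simp only [real_inner_smul_right, orthonormal_iff_ite.mp b.orthonormal]
    split_ifs with h <;> simp [h]
  have hcompact : ∀ F, IsCompactOperator (Q F ∘L T) := by
    intro F
    have h1 : ∀ G : Finset ι, IsCompactOperator (Q G) := by
      intro G
      refine Finset.sum_induction _ (fun S : H →L[ℝ] H => IsCompactOperator S)
        (fun S S' hS hS' => hS.add hS') isCompactOperator_zero (fun i _ => ?_)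
      have h2 : IsCompactOperator (innerSL ℝ (b i)) :=
        isCompactOperator_of_locallyCompactSpace_dom (innerSL ℝ (b i))
      exact h2.clm_comp ((1 : ℝ →L[ℝ] ℝ).smulRight (b i))
    exact (h1 F).comp_clm T
  let d : ι → ℝ := fun i => ⟪b i, T (b i)⟫_ℝ
  have hd : ∀ i, 0 ≤ d i := fun i => hT.inner_nonneg_right _
  have hbound : ∀ F : Finset ι, ‖Q F ∘L T - T‖ ≤ √(‖T‖ * (∑' i, d i - ∑ i ∈ F, d i)) := by
    intro F
    have htail : HasSum (fun j => if j ∈ F then 0 else d j) (∑' i, d i - ∑ i ∈ F, d i) := by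
      have h1 := hs.hasSum.sub (hasSum_sum_of_ne_finset_zero
        (f := fun j => if j ∈ F then d j else 0) (s := F) (by intro j hj; simp [hj]))
      have h2 : ∑ j ∈ F, (if j ∈ F then d j else 0) = ∑ j ∈ F, d j :=
        Finset.sum_congr rfl fun j hj => if_pos hj
      rw [h2] at h1
      refine h1.congr_fun fun j => ?_
      by_cases hj : j ∈ F <;> simp [hj, d]
    have ht0 : 0 ≤ ∑' i, d i - ∑ i ∈ F, d i :=
      htail.nonneg fun j => by split_ifs <;> simp [hd]
    refine ContinuousLinearMap.opNorm_le_bound _ (Real.sqrt_nonneg _) fun x => ?_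
    have hTx : ⟪x, T x⟫_ℝ ≤ ‖T‖ * ‖x‖ ^ 2 := by
      have := (real_inner_le_norm x (T x)).trans
        (mul_le_mul_of_nonneg_left (T.le_opNorm x) (norm_nonneg x))
      linarith
    -- By Parseval only the coefficients `⟪b j, T x⟫` with `j ∉ F` contribute, and Cauchy–Schwarz
    -- for `T` bounds their squares by `d j * ⟪x, T x⟫`.
    have hle : ‖T x - Q F (T x)‖ ^ 2 ≤ (∑' i, d i - ∑ i ∈ F, d i) * (‖T‖ * ‖x‖ ^ 2) := by
      refine hasSum_le (fun j => ?_) (hasSum_inner_sq b (T x - Q F (T x)))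
        (htail.mul_right _)
      rw [hcoef]
      split_ifs
      · simp
      · exact (inner_sq_le_of_isPositive hT (b j) x).trans
          (mul_le_mul_of_nonneg_left hTx (hd j))
    rw [sub_apply, ContinuousLinearMap.comp_apply, norm_sub_rev]
    refine Real.le_sqrt_of_sq_le hle |>.trans (le_of_eq ?_)
    rw [← Real.sqrt_sq (norm_nonneg x), ← Real.sqrt_mul (by positivity),
      Real.sqrt_sq (norm_nonneg x)]
    congr 1; ring
  have hlim : Filter.Tendsto (fun F => Q F ∘L T) Filter.atTop (nhds T) := by
    rw [tendsto_iff_norm_sub_tendsto_zero]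
    have h0 : Filter.Tendsto (fun F : Finset ι => √(‖T‖ * (∑' i, d i - ∑ i ∈ F, d i)))
        Filter.atTop (nhds 0) := by
      have h1 := ((tendsto_const_nhds (x := ∑' i, d i)).sub hs.hasSum).const_mul ‖T‖
      have h2 := (Real.continuous_sqrt.tendsto _).comp h1
      simpa [d, Function.comp_def] using h2
    exact squeeze_zero (fun F => norm_nonneg _) hbound h0
  exact isCompactOperator_of_tendsto hlim (Filter.Eventually.of_forall hcompact)

theorem completeSpace_eigenspace [CompleteSpace H] (T : H →L[ℝ] H) (μ : ℝ) :
    CompleteSpace (Module.End.eigenspace (T : H →ₗ[ℝ] H) μ) := by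
  have h : ((Module.End.eigenspace (T : H →ₗ[ℝ] H) μ : Submodule ℝ H) : Set H) =
      {x | T x = μ • x} := by
    ext x
    exact Module.End.mem_eigenspace_iff
  refine IsClosed.completeSpace_coe (hs := ?_)
  rw [h]
  exact isClosed_eq T.continuous (continuous_const_smul μ)

/-- A compact symmetric operator on a Hilbert space has a Hilbert basis of eigenvectors. -/
theorem exists_hilbertBasis_eigenvectors {T : H →L[ℝ] H} [CompleteSpace H]
    (hc : IsCompactOperator T) (hT : (T : H →ₗ[ℝ] H).IsSymmetric) :
    ∃ (ι : Type u) (b : HilbertBasis ι ℝ H) (ev : ι → ℝ), ∀ i, T (b i) = ev i • b i := by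
  have hcomplete := completeSpace_eigenspace T
  -- All real `μ` are admitted: the eigenspace is zero, and its basis empty, unless `μ` is an
  -- eigenvalue.
  choose w b hb using fun μ : ℝ =>
    exists_hilbertBasis ℝ (Module.End.eigenspace (T : H →ₗ[ℝ] H) μ)
  let v : (Σ μ : ℝ, w μ) → H := fun i => (b i.1 i.2 : H)
  have hv : Orthonormal ℝ v :=
    hT.orthogonalFamily_eigenspaces.orthonormal_sigma_orthonormal (v_family := fun μ => b μ)
      (fun μ => (b μ).orthonormal)
  have hbot : (Submodule.span ℝ (Set.range v))ᗮ = ⊥ := by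
    rw [eq_bot_iff, ← ContinuousLinearMap.orthogonalComplement_iSup_eigenspaces_eq_bot hc hT]
    intro x hx
    rw [Submodule.mem_orthogonal'] at hx
    rw [← Submodule.iInf_orthogonal, Submodule.mem_iInf]
    intro μ
    rw [Submodule.mem_orthogonal']
    intro y hy
    have hsum := ((b μ).hasSum_repr ⟨y, hy⟩).mapL
      ((innerSL ℝ x).comp (Module.End.eigenspace (T : H →ₗ[ℝ] H) μ).subtypeL)
    have hzero : ∀ i : w μ, ⟪x, (b μ i : H)⟫_ℝ = 0 := fun i =>
      hx (v ⟨μ, i⟩) (Submodule.subset_span ⟨_, rfl⟩)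
    simp only [map_smul, ContinuousLinearMap.comp_apply, Submodule.subtypeL_apply,
      innerSL_apply_apply, hzero, smul_zero] at hsum
    exact hsum.unique hasSum_zero
  have hcoe := HilbertBasis.coe_mkOfOrthogonalEqBot hv hbot
  generalize HilbertBasis.mkOfOrthogonalEqBot hv hbot = B at hcoe
  refine ⟨_, B, fun i => i.1, fun i => ?_⟩
  rw [hcoe]
  exact Module.End.mem_eigenspace_iff.mp (b i.1 i.2).2

/-- The trace may be computed in Hilbert bases with an arbitrary index type. -/
theorem HasTrace.hasSum {T : H →L[ℝ] H} {t : ℝ} (h : HasTrace T t) {ι : Type*}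
    (b : HilbertBasis ι ℝ H) [CompleteSpace H] : HasSum (fun i => ⟪b i, T (b i)⟫_ℝ) t := by
  -- `HasTrace` quantifies over bases indexed by subsets of `H`, so `b` is re-indexed by its range.
  have hv : Orthonormal ℝ ((↑) : Set.range b → H) := b.orthonormal.toSubtypeRange
  have hsp : ⊤ ≤ (Submodule.span ℝ (Set.range ((↑) : Set.range b → H))).topologicalClosure := by
    rw [Subtype.range_coe, b.dense_span]
  have hs := h _ (HilbertBasis.mk hv hsp)
  rw [HilbertBasis.coe_mk] at hs
  exact (Equiv.ofInjective b b.orthonormal.linearIndependent.injective).hasSum_iff.mpr hs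

/-- A state has a Hilbert basis of eigenvectors, and its eigenvalues form a probability
distribution. -/
theorem IsState.exists_eigenbasis {ρ : H →L[ℝ] H} (h : IsState ρ) [CompleteSpace H] :
    ∃ (ι : Type u) (b : HilbertBasis ι ℝ H) (ev : ι → ℝ),
      (∀ i, ρ (b i) = ev i • b i) ∧ (∀ i, 0 ≤ ev i) ∧ HasSum ev 1 := by
  obtain ⟨w, e, -⟩ := exists_hilbertBasis ℝ H
  have hc := isCompactOperator_of_summable_diagonal h.isPositive e (h.hasTrace w e).summable
  obtain ⟨ι, b, ev, hb⟩ := exists_hilbertBasis_eigenvectors hc h.isPositive.isSymmetric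
  have hd : ∀ i, ⟪b i, ρ (b i)⟫_ℝ = ev i := by
    intro i
    rw [hb, real_inner_smul_right, real_inner_self_eq_norm_sq, b.orthonormal.1 i]
    simp
  refine ⟨ι, b, ev, hb, fun i => ?_, ?_⟩
  · rw [← hd]; exact h.isPositive.inner_nonneg_right _
  · simpa only [hd] using h.hasTrace.hasSum b

end Spectral

/-! ### Algebra of tensor products of operators -/

section TensorAlgebra

variable {H K H' K' L M : Type*}
  [NormedAddCommGroup H] [InnerProductSpace ℝ H]
  [NormedAddCommGroup K] [InnerProductSpace ℝ K]
  [NormedAddCommGroup H'] [InnerProductSpace ℝ H']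
  [NormedAddCommGroup K'] [InnerProductSpace ℝ K']
  [NormedAddCommGroup L] [InnerProductSpace ℝ L]
  [NormedAddCommGroup M] [InnerProductSpace ℝ M]

theorem span_tmk_topologicalClosure :
    (Submodule.span ℝ (Set.range fun p : H × K => tmk p.1 p.2)).topologicalClosure = ⊤ := by
  rw [← Submodule.dense_iff_topologicalClosure_eq_top]
  refine (denseRange_incl H K).mono ?_
  rintro _ ⟨z, rfl⟩
  induction z using TensorProduct.induction_on with
  | zero => simp
  | add a b ha hb => rw [map_add]; exact Submodule.add_mem _ ha hb
  | tmul x y => exact Submodule.subset_span ⟨(x, y), rfl⟩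

/-- Bounded operators that agree on elementary tensors are equal. -/
theorem ext_tmk {S T : HTensor H K →L[ℝ] L} (h : ∀ x y, S (tmk x y) = T (tmk x y)) : S = T := by
  refine ContinuousLinearMap.ext_on
    (Submodule.dense_iff_topologicalClosure_eq_top.mpr span_tmk_topologicalClosure) ?_
  rintro _ ⟨p, rfl⟩
  exact h p.1 p.2

theorem tmk_add_left (x x' : H) (y : K) : tmk (x + x') y = tmk x y + tmk x' y := by
  simp [tmk, TensorProduct.add_tmul]

theorem tmk_add_right (x : H) (y y' : K) : tmk x (y + y') = tmk x y + tmk x y' := by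
  simp [tmk, TensorProduct.tmul_add]

theorem tmk_smul_left (r : ℝ) (x : H) (y : K) : tmk (r • x) y = r • tmk x y := by
  rw [tmk, ← TensorProduct.smul_tmul', map_smul, tmk]

theorem tmk_smul_right (r : ℝ) (x : H) (y : K) : tmk x (r • y) = r • tmk x y := by
  simp [tmk]

theorem opTensor_comp (S : H' →L[ℝ] L) (T : K' →L[ℝ] M) (S' : H →L[ℝ] H') (T' : K →L[ℝ] K') :
    opTensor S T ∘L opTensor S' T' = opTensor (S ∘L S') (T ∘L T') :=
  ext_tmk fun x y => by simp [opTensor_tmk]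

theorem opTensor_mul (S S' : H →L[ℝ] H) (T T' : K →L[ℝ] K) :
    opTensor S T * opTensor S' T' = opTensor (S * S') (T * T') :=
  opTensor_comp S T S' T'

theorem opTensor_one : opTensor (1 : H →L[ℝ] H) (1 : K →L[ℝ] K) = 1 :=
  ext_tmk fun x y => by simp [opTensor_tmk]

theorem opTensor_add_left (S S' : H →L[ℝ] H') (T : K →L[ℝ] K') :
    opTensor (S + S') T = opTensor S T + opTensor S' T :=
  ext_tmk fun x y => by simp [opTensor_tmk, tmk_add_left]

theorem opTensor_add_right (S : H →L[ℝ] H') (T T' : K →L[ℝ] K') :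
    opTensor S (T + T') = opTensor S T + opTensor S T' :=
  ext_tmk fun x y => by simp [opTensor_tmk, tmk_add_right]

theorem opTensor_smul_left (r : ℝ) (S : H →L[ℝ] H') (T : K →L[ℝ] K') :
    opTensor (r • S) T = r • opTensor S T :=
  ext_tmk fun x y => by simp [opTensor_tmk, tmk_smul_left]

theorem opTensor_smul_right (r : ℝ) (S : H →L[ℝ] H') (T : K →L[ℝ] K') :
    opTensor S (r • T) = r • opTensor S T :=
  ext_tmk fun x y => by simp [opTensor_tmk, tmk_smul_right]

/-- `opTensor` as a bilinear map. -/
noncomputable def opTensorₗ :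
    (H →L[ℝ] H') →ₗ[ℝ] (K →L[ℝ] K') →ₗ[ℝ] (HTensor H K →L[ℝ] HTensor H' K') :=
  LinearMap.mk₂ ℝ opTensor opTensor_add_left opTensor_smul_left opTensor_add_right
    opTensor_smul_right

theorem opTensorₗ_apply (S : H →L[ℝ] H') (T : K →L[ℝ] K') : opTensorₗ S T = opTensor S T := rfl

/-- A pair of formally adjoint operators: `⟪S u, v⟫ = ⟪u, T v⟫`. -/
theorem inner_opTensor {S S' : H →L[ℝ] H} {T T' : K →L[ℝ] K}
    (hS : ∀ x y, ⟪S x, y⟫_ℝ = ⟪x, S' y⟫_ℝ) (hT : ∀ x y, ⟪T x, y⟫_ℝ = ⟪x, T' y⟫_ℝ)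
    (u v : HTensor H K) : ⟪opTensor S T u, v⟫_ℝ = ⟪u, opTensor S' T' v⟫_ℝ := by
  -- Density is used one variable at a time: in `v` for an elementary tensor on the left, then in
  -- `u`.
  have h₁ : ∀ x y v, ⟪opTensor S T (tmk x y), v⟫_ℝ = ⟪tmk x y, opTensor S' T' v⟫_ℝ := by
    intro x y v
    have h : innerSL ℝ (opTensor S T (tmk x y)) =
        (innerSL ℝ (tmk x y)).comp (opTensor S' T') :=
      ext_tmk fun x' y' => by simp [opTensor_tmk, inner_tmk, hS, hT]
    exact congrArg (fun F => F v) h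
  have h : (innerSL ℝ v).comp (opTensor S T) = innerSL ℝ (opTensor S' T' v) :=
    ext_tmk fun x y => by simpa [real_inner_comm] using h₁ x y v
  rw [real_inner_comm, real_inner_comm (opTensor S' T' v)]
  exact congrArg (fun F => F u) h

theorem norm_tmk (x : H) (y : K) : ‖tmk x y‖ = ‖x‖ * ‖y‖ := by
  rw [tmk, LinearIsometry.norm_map, TensorProduct.norm_tmul]

end TensorAlgebra

/-! ### Almost anticommuting operators -/

section Robust

variable {V : Type*} [NormedAddCommGroup V] [InnerProductSpace ℝ V]

/-- If the anticommuting operators `D`, `D'` act on `φ` nearly like the operators `S`, `S'`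
commuting with them, then `S` and `S'` nearly anticommute on `φ`. -/
theorem norm_anticommutator_le {S S' D D' : V →L[ℝ] V} {φ : V} {R : ℝ}
    (hS : ∀ x, ‖S x‖ = ‖x‖) (hS' : ∀ x, ‖S' x‖ = ‖x‖)
    (hD : ∀ x, ‖D x‖ ≤ 2 * ‖x‖) (hD' : ∀ x, ‖D' x‖ ≤ 2 * ‖x‖)
    (hSD' : ∀ x, S (D' x) = D' (S x)) (hS'D : ∀ x, S' (D x) = D (S' x))
    (hanti : ∀ x, D (D' x) + D' (D x) = 0)
    (hr : ‖D φ - S φ‖ ≤ R) (hr' : ‖D' φ - S' φ‖ ≤ R) :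
    ‖S' (S φ) + S (S' φ)‖ ≤ 6 * R := by
  -- Telescoping down to `D D' + D' D = 0` leaves four residuals, of norms at most `R`, `2R`, `R`,
  -- `2R`.
  have key : S' (S φ) + S (S' φ) = -(S' (D φ - S φ) + D (D' φ - S' φ)
      + (S (D' φ - S' φ) + D' (D φ - S φ))) := by
    have h := hanti φ
    simp only [map_sub, hSD', hS'D]
    rw [← sub_eq_zero]
    calc _ = D (D' φ) + D' (D φ) := by abel
      _ = 0 := h
  rw [key, norm_neg]
  have h1 := norm_add_le (S' (D φ - S φ)) (D (D' φ - S' φ))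
  have h2 := norm_add_le (S (D' φ - S' φ)) (D' (D φ - S φ))
  have h3 := norm_add_le (S' (D φ - S φ) + D (D' φ - S' φ)) (S (D' φ - S' φ) + D' (D φ - S φ))
  rw [hS'] at h1
  rw [hS] at h2
  have h4 := hD (D' φ - S' φ)
  have h5 := hD' (D φ - S φ)
  linarith

/-- Three pairs of anticommuting operators acting on `φ` nearly like pairs of the operators
`A 0`, `A 1`, `A 2` force the triple product `A 0 * A 1 * A 2` to be nearly opposite to its
transpose. -/
theorem two_mul_norm_sq_sub_le_inner {A : Fin 3 → V →L[ℝ] V} {D : Fin 6 → V →L[ℝ] V}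
    (hAn : ∀ i x, ‖A i x‖ = ‖x‖) (hAs : ∀ i x y, ⟪A i x, y⟫_ℝ = ⟪x, A i y⟫_ℝ)
    (hD : ∀ k x, ‖D k x‖ ≤ 2 * ‖x‖) (hAD : ∀ i k x, A i (D k x) = D k (A i x))
    (h01 : ∀ x, D 0 (D 1 x) + D 1 (D 0 x) = 0) (h23 : ∀ x, D 2 (D 3 x) + D 3 (D 2 x) = 0)
    (h45 : ∀ x, D 4 (D 5 x) + D 5 (D 4 x) = 0) {φ : V} {R : ℝ}
    (r0 : ‖D 0 φ - A 0 φ‖ ≤ R) (r1 : ‖D 1 φ - A 1 φ‖ ≤ R) (r2 : ‖D 2 φ - A 0 φ‖ ≤ R)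
    (r3 : ‖D 3 φ - A 2 φ‖ ≤ R) (r4 : ‖D 4 φ - A 1 φ‖ ≤ R) (r5 : ‖D 5 φ - A 2 φ‖ ≤ R) :
    2 * ‖φ‖ ^ 2 - 40 * R * ‖φ‖ ≤
      ⟪φ, A 0 (A 1 (A 2 (D 0 (D 1 (D 3 φ))))) - A 2 (A 1 (A 0 (D 0 (D 1 (D 3 φ)))))⟫_ℝ := by
  have e01 := norm_anticommutator_le (hAn 0) (hAn 1) (hD 0) (hD 1) (hAD 0 1) (hAD 1 0) h01 r0 r1
  have e02 := norm_anticommutator_le (hAn 0) (hAn 2) (hD 2) (hD 3) (hAD 0 3) (hAD 2 2) h23 r2 r3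
  have e12 := norm_anticommutator_le (hAn 1) (hAn 2) (hD 4) (hD 5) (hAD 1 5) (hAD 2 4) h45 r4 r5
  set p := A 2 (A 1 (A 0 φ)) with hp
  set q := A 0 (A 1 (A 2 φ)) with hq
  -- Replace `D 3`, `D 1`, `D 0` in turn by `A 2`, `A 1`, `A 0`, moving each `A` to the left of the
  -- remaining `D`; this reverses the order and costs `4R + 2R + R`.
  set ε := A 2 (A 1 (D 0 φ - A 0 φ)) + A 2 (D 0 (D 1 φ - A 1 φ)) + D 0 (D 1 (D 3 φ - A 2 φ))
    with hε
  -- Three exchanges relate `p` to `-q`. The middle one acts on `A 1 φ`, where no anticommutation is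
  -- known; trading `A 1 φ` for `D 1 φ` lets `D 1` move out in front. The four terms cost `6R + 12R
  -- + 2R + 6R`.
  set η := A 2 (A 1 (A 0 φ) + A 0 (A 1 φ)) - D 1 (A 2 (A 0 φ) + A 0 (A 2 φ))
    + (A 2 (A 0 (D 1 φ - A 1 φ)) + A 0 (A 2 (D 1 φ - A 1 φ)))
    + A 0 (A 2 (A 1 φ) + A 1 (A 2 φ)) with hη
  have hX : D 0 (D 1 (D 3 φ)) = p + ε := by
    simp only [hp, hε, map_sub, hAD]; abel
  have hpq : q = η - p := by
    simp only [hp, hq, hη, map_sub, map_add, hAD]; abel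
  have hinner : ⟪φ, A 0 (A 1 (A 2 (D 0 (D 1 (D 3 φ))))) - A 2 (A 1 (A 0 (D 0 (D 1 (D 3 φ)))))⟫_ℝ
      = ⟪p - q, D 0 (D 1 (D 3 φ))⟫_ℝ := by
    rw [inner_sub_right, inner_sub_left, hp, hq]
    simp only [hAs]
  have np : ‖p‖ = ‖φ‖ := by simp only [hp, hAn]
  have nq : ‖q‖ = ‖φ‖ := by simp only [hq, hAn]
  have nε : ‖ε‖ ≤ 7 * R := by
    have t1 : ‖A 2 (A 1 (D 0 φ - A 0 φ))‖ ≤ R := by rwa [hAn, hAn]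
    have t2 : ‖A 2 (D 0 (D 1 φ - A 1 φ))‖ ≤ 2 * R := by
      rw [hAn]; exact (hD _ _).trans (by linarith)
    have t3 : ‖D 0 (D 1 (D 3 φ - A 2 φ))‖ ≤ 4 * R :=
      (hD _ _).trans (by linarith [hD 1 (D 3 φ - A 2 φ)])
    have := norm_add₃_le (a := A 2 (A 1 (D 0 φ - A 0 φ))) (b := A 2 (D 0 (D 1 φ - A 1 φ)))
      (c := D 0 (D 1 (D 3 φ - A 2 φ)))
    linarith
  have nη : ‖η‖ ≤ 26 * R := by
    have t1 : ‖A 2 (A 1 (A 0 φ) + A 0 (A 1 φ))‖ ≤ 6 * R := by rwa [hAn]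
    have t2 : ‖D 1 (A 2 (A 0 φ) + A 0 (A 2 φ))‖ ≤ 12 * R := (hD _ _).trans (by linarith)
    have t3 : ‖A 2 (A 0 (D 1 φ - A 1 φ)) + A 0 (A 2 (D 1 φ - A 1 φ))‖ ≤ 2 * R := by
      refine (norm_add_le _ _).trans ?_
      simp only [hAn]
      linarith
    have t4 : ‖A 0 (A 2 (A 1 φ) + A 1 (A 2 φ))‖ ≤ 6 * R := by rwa [hAn]
    refine (norm_add_le _ _).trans ?_
    have := norm_add_le (A 2 (A 1 (A 0 φ) + A 0 (A 1 φ)) - D 1 (A 2 (A 0 φ) + A 0 (A 2 φ)))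
      (A 2 (A 0 (D 1 φ - A 1 φ)) + A 0 (A 2 (D 1 φ - A 1 φ)))
    have := norm_sub_le (A 2 (A 1 (A 0 φ) + A 0 (A 1 φ))) (D 1 (A 2 (A 0 φ) + A 0 (A 2 φ)))
    linarith
  -- Since `p - q = 2p - η`, the main term is `2 ‖φ‖²`; the errors add up to `26 + 2 * 7 = 40` times
  -- `R ‖φ‖`.
  have hsplit : ⟪p - q, D 0 (D 1 (D 3 φ))⟫_ℝ = 2 * ‖φ‖ ^ 2 - ⟪η, p⟫_ℝ + ⟪p - q, ε⟫_ℝ := by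
    rw [hX, inner_add_right]
    congr 1
    rw [hpq, inner_sub_left, inner_sub_left, real_inner_self_eq_norm_sq, np]
    ring
  have b1 : ⟪η, p⟫_ℝ ≤ 26 * R * ‖φ‖ := by
    refine (real_inner_le_norm _ _).trans ?_
    rw [np]
    exact mul_le_mul_of_nonneg_right nη (norm_nonneg _)
  have b2 : -⟪p - q, ε⟫_ℝ ≤ 14 * R * ‖φ‖ := by
    rw [← inner_neg_right]
    refine (real_inner_le_norm _ _).trans ?_
    rw [norm_neg]
    have hn : ‖p - q‖ ≤ 2 * ‖φ‖ := (norm_sub_le _ _).trans (by rw [np, nq]; linarith)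
    calc ‖p - q‖ * ‖ε‖ ≤ 2 * ‖φ‖ * (7 * R) :=
          mul_le_mul hn nε (norm_nonneg _) (by positivity)
      _ = _ := by ring
  rw [hinner, hsplit]
  linarith

/-- The sum of squares for the CHSH expression. -/
theorem chsh_sum_of_squares {x y p q : V} {n : ℝ} (hx : ‖x‖ = n) (hy : ‖y‖ = n) (hp : ‖p‖ = n)
    (hq : ‖q‖ = n) :
    ‖(√2)⁻¹ • (x + y) - p‖ ^ 2 + ‖(√2)⁻¹ • (x - y) - q‖ ^ 2 =
      4 * n ^ 2 - √2 * (⟪p, x + y⟫_ℝ + ⟪q, x - y⟫_ℝ) := by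
  have h2 : √2 * √2 = 2 := Real.mul_self_sqrt (by norm_num)
  have hinv : (√2)⁻¹ = √2 / 2 := by
    rw [inv_eq_one_div, div_eq_div_iff (by positivity) (by norm_num)]; linarith
  have hpar := parallelogram_law_with_norm ℝ x y
  rw [norm_sub_sq_real, norm_sub_sq_real, norm_smul, norm_smul, real_inner_smul_left,
    real_inner_smul_left, hp, hq, real_inner_comm p, real_inner_comm q, hinv,
    Real.norm_of_nonneg (by positivity)]
  rw [hx, hy] at hpar
  have h4 : (√2 / 2) ^ 2 = 1 / 2 := by rw [div_pow, sq, h2]; norm_num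
  rw [mul_pow, mul_pow, h4]
  linarith

theorem le_sqrt_of_sum_sq_eq {a b c d e f s : ℝ}
    (h : a ^ 2 + b ^ 2 + (c ^ 2 + d ^ 2) + (e ^ 2 + f ^ 2) = s) :
    a ≤ √s ∧ b ≤ √s ∧ c ≤ √s ∧ d ≤ √s ∧ e ≤ √s ∧ f ≤ √s := by
  have := sq_nonneg a
  have := sq_nonneg b
  have := sq_nonneg c
  have := sq_nonneg d
  have := sq_nonneg e
  have := sq_nonneg f
  refine ⟨?_, ?_, ?_, ?_, ?_, ?_⟩ <;> exact Real.le_sqrt_of_sq_le (by linarith)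

variable (A : Fin 3 → V →L[ℝ] V) (C : Fin 6 → V →L[ℝ] V)

/-- The operator of the functional `chshThree` without signs, as a quadratic form. -/
noncomputable def chshForm (φ : V) : ℝ :=
  ⟪A 0 φ, C 0 φ + C 1 φ⟫_ℝ + ⟪A 1 φ, C 0 φ - C 1 φ⟫_ℝ + ⟪A 0 φ, C 2 φ + C 3 φ⟫_ℝ
    + ⟪A 2 φ, C 2 φ - C 3 φ⟫_ℝ + ⟪A 1 φ, C 4 φ + C 5 φ⟫_ℝ + ⟪A 2 φ, C 4 φ - C 5 φ⟫_ℝ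

/-- The product of the operators that stand in for `A 0`, `A 1`, `A 2` on the side of Charlie. -/
noncomputable def tripleOp : V →L[ℝ] V :=
  ((√2)⁻¹ • (C 0 + C 1)) * ((√2)⁻¹ • (C 0 - C 1)) * ((√2)⁻¹ • (C 2 - C 3))

variable {A C}

/-- The six squares from the three CHSH identities add up to `Δ`, so each residual is at most `√Δ`.
Half of the main term is given up to make the bound linear in the CHSH value, so that it can be
summed over Bob's outcomes. -/
theorem norm_sq_sub_le_inner_tripleOp
    (hAn : ∀ i x, ‖A i x‖ = ‖x‖) (hAs : ∀ i x y, ⟪A i x, y⟫_ℝ = ⟪x, A i y⟫_ℝ)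
    (hCn : ∀ k x, ‖C k x‖ = ‖x‖) (hC2 : ∀ k x, C k (C k x) = x)
    (hAC : ∀ i k x, A i (C k x) = C k (A i x)) (φ : V) :
    ‖φ‖ ^ 2 - 400 * √2 * (6 * √2 * ‖φ‖ ^ 2 - chshForm A C φ) ≤
      ⟪φ, A 0 (A 1 (A 2 (tripleOp C φ))) - A 2 (A 1 (A 0 (tripleOp C φ)))⟫_ℝ := by
  let D : Fin 6 → V →L[ℝ] V := ![(√2)⁻¹ • (C 0 + C 1), (√2)⁻¹ • (C 0 - C 1),
    (√2)⁻¹ • (C 2 + C 3), (√2)⁻¹ • (C 2 - C 3), (√2)⁻¹ • (C 4 + C 5), (√2)⁻¹ • (C 4 - C 5)]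
  have h2 : √2 * √2 = 2 := Real.mul_self_sqrt (by norm_num)
  have hs1 : (√2)⁻¹ ≤ 1 := inv_le_one_of_one_le₀ (Real.one_le_sqrt.mpr (by norm_num))
  have hplus : ∀ k l x, ‖((√2)⁻¹ • (C k + C l)) x‖ ≤ 2 * ‖x‖ := by
    intro k l x
    rw [smul_apply, add_apply, norm_smul, Real.norm_of_nonneg (by positivity)]
    have := norm_add_le (C k x) (C l x)
    rw [hCn, hCn] at this
    calc (√2)⁻¹ * ‖C k x + C l x‖ ≤ 1 * (‖x‖ + ‖x‖) :=
          mul_le_mul hs1 this (norm_nonneg _) zero_le_one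
      _ = _ := by ring
  have hminus : ∀ k l x, ‖((√2)⁻¹ • (C k - C l)) x‖ ≤ 2 * ‖x‖ := by
    intro k l x
    rw [smul_apply, sub_apply, norm_smul, Real.norm_of_nonneg (by positivity)]
    have := norm_sub_le (C k x) (C l x)
    rw [hCn, hCn] at this
    calc (√2)⁻¹ * ‖C k x - C l x‖ ≤ 1 * (‖x‖ + ‖x‖) :=
          mul_le_mul hs1 this (norm_nonneg _) zero_le_one
      _ = _ := by ring
  have hanti : ∀ k l x, ((√2)⁻¹ • (C k + C l)) (((√2)⁻¹ • (C k - C l)) x)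
      + ((√2)⁻¹ • (C k - C l)) (((√2)⁻¹ • (C k + C l)) x) = 0 := by
    intro k l x
    simp only [smul_apply, add_apply, sub_apply, map_smul, map_add, map_sub,
      hC2, smul_add, smul_sub]
    abel
  have hAD : ∀ i k x, A i (D k x) = D k (A i x) := by
    intro i k x
    fin_cases k <;> simp [D, hAC]
  have hDn : ∀ k x, ‖D k x‖ ≤ 2 * ‖x‖ := by
    intro k x
    fin_cases k
    exacts [hplus 0 1 x, hminus 0 1 x, hplus 2 3 x, hminus 2 3 x, hplus 4 5 x, hminus 4 5 x]
  have s1 := chsh_sum_of_squares (hCn 0 φ) (hCn 1 φ) (hAn 0 φ) (hAn 1 φ)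
  have s2 := chsh_sum_of_squares (hCn 2 φ) (hCn 3 φ) (hAn 0 φ) (hAn 2 φ)
  have s3 := chsh_sum_of_squares (hCn 4 φ) (hCn 5 φ) (hAn 1 φ) (hAn 2 φ)
  set Δ := √2 * (6 * √2 * ‖φ‖ ^ 2 - chshForm A C φ) with hΔ
  have hsum : ‖D 0 φ - A 0 φ‖ ^ 2 + ‖D 1 φ - A 1 φ‖ ^ 2 + (‖D 2 φ - A 0 φ‖ ^ 2
      + ‖D 3 φ - A 2 φ‖ ^ 2) + (‖D 4 φ - A 1 φ‖ ^ 2 + ‖D 5 φ - A 2 φ‖ ^ 2) = Δ := by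
    have e : Δ = 12 * ‖φ‖ ^ 2 - √2 * chshForm A C φ := by
      rw [hΔ]; linear_combination 6 * ‖φ‖ ^ 2 * h2
    rw [e, chshForm]
    refine (congrArg₂ (· + ·) (congrArg₂ (· + ·) s1 s2) s3).trans ?_
    ring
  obtain ⟨r0, r1, r2, r3, r4, r5⟩ := le_sqrt_of_sum_sq_eq hsum
  have main := two_mul_norm_sq_sub_le_inner hAn hAs hDn hAD (hanti 0 1) (hanti 2 3) (hanti 4 5)
    r0 r1 r2 r3 r4 r5
  have hΔ0 : 0 ≤ Δ := by rw [← hsum]; positivity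
  have hsq := Real.sq_sqrt hΔ0
  -- Trading `√Δ` for `Δ` by AM–GM is the origin of the constant 400.
  have hamgm : 40 * √Δ * ‖φ‖ ≤ ‖φ‖ ^ 2 + 400 * Δ := by
    nlinarith [sq_nonneg (‖φ‖ - 20 * √Δ)]
  have hgoal : ‖φ‖ ^ 2 - 400 * Δ ≤ 2 * ‖φ‖ ^ 2 - 40 * √Δ * ‖φ‖ := by linarith
  rw [mul_assoc]
  exact hgoal.trans main

end Robust

/-! ### Operators on one tensor factor and regrouping -/

section Factors

variable {H K L : Type*}
  [NormedAddCommGroup H] [InnerProductSpace ℝ H]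
  [NormedAddCommGroup K] [InnerProductSpace ℝ K]
  [NormedAddCommGroup L] [InnerProductSpace ℝ L]

variable (H K) in
/-- `S ↦ S ⊗ 1`. -/
noncomputable def opLeft : (H →L[ℝ] H) →ₐ[ℝ] (HTensor H K →L[ℝ] HTensor H K) :=
  AlgHom.ofLinearMap (opTensorₗ.flip 1) opTensor_one
    (fun S S' => by simp [opTensorₗ_apply, opTensor_mul])

variable (H K) in
/-- `T ↦ 1 ⊗ T`. -/
noncomputable def opRight : (K →L[ℝ] K) →ₐ[ℝ] (HTensor H K →L[ℝ] HTensor H K) :=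
  AlgHom.ofLinearMap (opTensorₗ 1) opTensor_one
    (fun S S' => by simp [opTensorₗ_apply, opTensor_mul])

theorem opLeft_apply (S : H →L[ℝ] H) : opLeft H K S = opTensor S 1 := rfl

theorem opRight_apply (T : K →L[ℝ] K) : opRight H K T = opTensor 1 T := rfl

theorem opTensor_eq_mul (S : H →L[ℝ] H) (T : K →L[ℝ] K) :
    opTensor S T = opLeft H K S * opRight H K T := by
  rw [opLeft_apply, opRight_apply, opTensor_mul, mul_one, one_mul]

theorem commute_opLeft_opRight (S : H →L[ℝ] H) (T : K →L[ℝ] K) :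
    Commute (opLeft H K S) (opRight H K T) := by
  rw [Commute, SemiconjBy, opLeft_apply, opRight_apply, opTensor_mul, opTensor_mul, mul_one,
    one_mul, mul_one, one_mul]

theorem inner_opLeft {S S' : H →L[ℝ] H} (h : ∀ x y, ⟪S x, y⟫_ℝ = ⟪x, S' y⟫_ℝ)
    (u v : HTensor H K) : ⟪opLeft H K S u, v⟫_ℝ = ⟪u, opLeft H K S' v⟫_ℝ :=
  inner_opTensor h (fun _ _ => rfl) u v

theorem inner_opRight {T T' : K →L[ℝ] K} (h : ∀ x y, ⟪T x, y⟫_ℝ = ⟪x, T' y⟫_ℝ)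
    (u v : HTensor H K) : ⟪opRight H K T u, v⟫_ℝ = ⟪u, opRight H K T' v⟫_ℝ :=
  inner_opTensor (fun _ _ => rfl) h u v

/-- The elementary tensors as a bounded bilinear map. -/
noncomputable def tmkL : H →L[ℝ] K →L[ℝ] HTensor H K :=
  LinearMap.mkContinuous₂
    (LinearMap.mk₂ ℝ tmk tmk_add_left tmk_smul_left tmk_add_right tmk_smul_right) 1
    (fun x y => by simp [norm_tmk])

variable {A B₁ B₂ C : Type*}
  [NormedAddCommGroup A] [InnerProductSpace ℝ A]
  [NormedAddCommGroup B₁] [InnerProductSpace ℝ B₁]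
  [NormedAddCommGroup B₂] [InnerProductSpace ℝ B₂]
  [NormedAddCommGroup C] [InnerProductSpace ℝ C]

theorem ext_tmk_tmk {S T : HTensor (HTensor A B₁) (HTensor B₂ C) →L[ℝ] L}
    (h : ∀ a b b' c, S (tmk (tmk a b) (tmk b' c)) = T (tmk (tmk a b) (tmk b' c))) : S = T := by
  refine ext_tmk fun x y => ?_
  have h1 : ∀ a b, S ∘L tmkL (tmk a b) = T ∘L tmkL (tmk a b) := fun a b =>
    ext_tmk fun b' c => h a b b' c
  have h2 : S ∘L tmkL.flip y = T ∘L tmkL.flip y :=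
    ext_tmk fun a b => congrArg (fun F => F y) (h1 a b)
  exact congrArg (fun F => F x) h2

theorem shuffle_opTensor (S : A →L[ℝ] A) (T : B₁ →L[ℝ] B₁) (T' : B₂ →L[ℝ] B₂) (U : C →L[ℝ] C)
    (w : HTensor (HTensor A B₁) (HTensor B₂ C)) :
    shuffle A B₁ B₂ C (opTensor (opTensor S T) (opTensor T' U) w) =
      opTensor S (opTensor (opTensor T T') U) (shuffle A B₁ B₂ C w) := by
  let W : HTensor (HTensor A B₁) (HTensor B₂ C) →L[ℝ] HTensor A (HTensor (HTensor B₁ B₂) C) :=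
    (shuffle A B₁ B₂ C).toContinuousLinearEquiv.toContinuousLinearMap
  have hW : ∀ v, W v = shuffle A B₁ B₂ C v := fun v => rfl
  have h : W ∘L opTensor (opTensor S T) (opTensor T' U) =
      opTensor S (opTensor (opTensor T T') U) ∘L W :=
    ext_tmk_tmk fun a b b' c => by
      simp only [ContinuousLinearMap.comp_apply, hW, opTensor_tmk, shuffle_tmk]
  exact congrArg (fun F => F w) h

/-- The Hilbert basis of elementary tensors. -/
theorem exists_hilbertBasis_tmk {ι κ : Type*} (b : HilbertBasis ι ℝ H) (b' : HilbertBasis κ ℝ K) :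
    ∃ B : HilbertBasis (ι × κ) ℝ (HTensor H K), ∀ i, B i = tmk (b i.1) (b' i.2) := by
  classical
  have hv : Orthonormal ℝ fun i : ι × κ => tmk (b i.1) (b' i.2) := by
    rw [orthonormal_iff_ite]
    rintro ⟨i, j⟩ ⟨i', j'⟩
    rw [inner_tmk, orthonormal_iff_ite.mp b.orthonormal, orthonormal_iff_ite.mp b'.orthonormal]
    by_cases hi : i = i' <;> by_cases hj : j = j' <;> simp [hi, hj]
  have hbot : (Submodule.span ℝ (Set.range fun i : ι × κ => tmk (b i.1) (b' i.2)))ᗮ = ⊥ := by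
    rw [eq_bot_iff]
    intro z hz
    rw [Submodule.mem_orthogonal'] at hz
    have h1 : ∀ j, (innerSL ℝ z) ∘L tmkL.flip (b' j) = 0 := fun j => by
      refine ContinuousLinearMap.ext_on
        (Submodule.dense_iff_topologicalClosure_eq_top.mpr b.dense_span) ?_
      rintro _ ⟨i, rfl⟩
      exact hz _ (Submodule.subset_span ⟨(i, j), rfl⟩)
    have h2 : ∀ x, (innerSL ℝ z) ∘L tmkL x = 0 := fun x => by
      refine ContinuousLinearMap.ext_on
        (Submodule.dense_iff_topologicalClosure_eq_top.mpr b'.dense_span) ?_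
      rintro _ ⟨j, rfl⟩
      exact congrArg (fun F => F x) (h1 j)
    have h3 : innerSL ℝ z = 0 := ext_tmk fun x y => congrArg (fun F => F y) (h2 x)
    exact inner_self_eq_zero.mp (congrArg (fun F => F z) h3)
  exact ⟨HilbertBasis.mkOfOrthogonalEqBot hv hbot, fun i => by
    rw [HilbertBasis.coe_mkOfOrthogonalEqBot]⟩

end Factors

/-! ### Observables -/

section Observables

variable {H : Type*} [NormedAddCommGroup H] [InnerProductSpace ℝ H]

/-- The observable `∑ a, a M_a` of a measurement with outcomes `±1`. -/
noncomputable def observable (M : ℤˣ → H →L[ℝ] H) : H →L[ℝ] H := ∑ a : ℤˣ, ((a : ℤ) : ℝ) • M a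

theorem observable_eq (M : ℤˣ → H →L[ℝ] H) : observable M = M 1 - M (-1) := by
  rw [observable, Fintype.sum_eq_add 1 (-1) (by decide)]
  · simp [sub_eq_add_neg]
  · intro a ha
    rcases Int.units_eq_one_or a with h | h <;> simp [h] at ha

variable [CompleteSpace H]

theorem inner_symm_of_isStarProjection {P : H →L[ℝ] H} (h : IsStarProjection P) (x y : H) :
    ⟪P x, y⟫_ℝ = ⟪x, P y⟫_ℝ :=
  ContinuousLinearMap.isSelfAdjoint_iff_isSymmetric.mp h.isSelfAdjoint x y

theorem inner_observable {M : ℤˣ → H →L[ℝ] H} (h : IsProjectiveMeasurement M) (x y : H) :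
    ⟪observable M x, y⟫_ℝ = ⟪x, observable M y⟫_ℝ := by
  simp only [observable_eq, sub_apply, inner_sub_left, inner_sub_right,
    inner_symm_of_isStarProjection (h.isProjection _)]

theorem observable_mul_self {M : ℤˣ → H →L[ℝ] H} (h : IsProjectiveMeasurement M) :
    observable M * observable M = 1 := by
  have h1 : M 1 + M (-1) = 1 := by
    rw [← h.sum_eq_one, Fintype.sum_eq_add 1 (-1) (by decide)]
    intro a ha
    rcases Int.units_eq_one_or a with h | h <;> simp [h] at ha
  have h2 : M 1 * M 1 = M 1 := (h.isProjection 1).isIdempotentElem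
  rw [observable_eq, eq_sub_of_add_eq' h1]
  calc _ = 4 • (M 1 * M 1) - 4 • M 1 + 1 := by noncomm_ring
    _ = 1 := by rw [h2]; abel

end Observables

/-! ### The functional on sums of families -/

section Functional

theorem chshThree_hasSum {ι : Type*} {F : ι → Family} {P : Family}
    (h : ∀ a b c x z, HasSum (fun i => F i a b c x z) (P a b c x z)) (b : Fin 2 × Fin 2) :
    HasSum (fun i => chshThree (F i) b) (chshThree P b) := by
  have hc : ∀ x z, HasSum (fun i => corr (F i) b x z) (corr P b x z) := fun x z =>
    hasSum_sum fun a _ => hasSum_sum fun c _ => ((h a b c x z).mul_right _).mul_right _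
  exact (((((((hc 0 0).add (hc 0 1)).mul_left _).add (((hc 1 0).sub (hc 1 1)).mul_left _)).add
    (((hc 0 2).add (hc 0 3)).mul_left _)).sub (((hc 2 2).sub (hc 2 3)).mul_left _)).add
    (((hc 1 4).add (hc 1 5)).mul_left _)).sub (((hc 2 4).sub (hc 2 5)).mul_left _)

theorem chshThree_const_mul (r : ℝ) (P : Family) (b : Fin 2 × Fin 2) :
    chshThree (fun a b c x z => r * P a b c x z) b = r * chshThree P b := by
  have hc : ∀ x z, corr (fun a b c x z => r * P a b c x z) b x z = r * corr P b x z := by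
    intro x z
    simp only [corr, Finset.mul_sum, mul_assoc]
  simp only [chshThree, hc]
  ring

theorem le_of_hasSum_weighted {ι : Type*} {w x : ι → ℝ} {y c : ℝ} (hw : ∀ i, 0 ≤ w i)
    (hw1 : HasSum w 1) (hy : HasSum (fun i => w i * x i) y) (hx : ∀ i, x i ≤ c) : y ≤ c := by
  have h := hasSum_le (fun i => mul_le_mul_of_nonneg_left (hx i) (hw i)) hy (hw1.mul_right c)
  rwa [one_mul] at h

/-- A convex bound on the functional is inherited by countable mixtures. -/
theorem sum_chshThree_le_of_mixture {ι : Type*} {w : ι → ℝ} {F : ι → Family} {P : Family} {r : ℝ}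
    (hw : ∀ i, 0 ≤ w i) (hw1 : HasSum w 1)
    (hP : ∀ a b c x z, HasSum (fun i => w i * F i a b c x z) (P a b c x z))
    (hF : ∀ i, ∑ b, chshThree (F i) b ≤ r) : ∑ b, chshThree P b ≤ r := by
  refine le_of_hasSum_weighted hw hw1 ?_ hF
  have h := hasSum_sum (s := Finset.univ) fun b (_ : b ∈ Finset.univ) => chshThree_hasSum hP b
  simpa only [chshThree_const_mul, ← Finset.mul_sum] using h

end Functional

/-! ### The real bound -/

theorem norm_apply_eq_of_involution {V : Type*} [NormedAddCommGroup V] [InnerProductSpace ℝ V]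
    {S : V →L[ℝ] V} (hs : ∀ x y, ⟪S x, y⟫_ℝ = ⟪x, S y⟫_ℝ) (h2 : ∀ x, S (S x) = x) (x : V) :
    ‖S x‖ = ‖x‖ := by
  rw [← sq_eq_sq₀ (norm_nonneg _) (norm_nonneg _), ← real_inner_self_eq_norm_sq,
    ← real_inner_self_eq_norm_sq, hs, h2]

theorem inner_pullback {H K : Type*} [NormedAddCommGroup H] [InnerProductSpace ℝ H]
    [NormedAddCommGroup K] [InnerProductSpace ℝ K] (U : H ≃ₗᵢ[ℝ] K) (T : K →L[ℝ] K) (x : H) :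
    ⟪x, pullback U T x⟫_ℝ = ⟪U x, T (U x)⟫_ℝ := by
  rw [pullback_apply, ← U.inner_map_map, U.apply_symm_apply]

theorem map_tripleOp {V W : Type*} [NormedAddCommGroup V] [InnerProductSpace ℝ V]
    [NormedAddCommGroup W] [InnerProductSpace ℝ W] (f : (V →L[ℝ] V) →ₐ[ℝ] (W →L[ℝ] W))
    (C : Fin 6 → V →L[ℝ] V) : f (tripleOp C) = tripleOp fun k => f (C k) := by
  simp only [tripleOp, map_mul, map_smul, map_add, map_sub]

namespace Model

variable {Λ A B₁ B₂ C : Type*}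
  [NormedAddCommGroup A] [InnerProductSpace ℝ A] [CompleteSpace A]
  [NormedAddCommGroup B₁] [InnerProductSpace ℝ B₁]
  [NormedAddCommGroup B₂] [InnerProductSpace ℝ B₂]
  [NormedAddCommGroup C] [InnerProductSpace ℝ C] [CompleteSpace C]

/-- The quadratic forms of the joint measurement operators at a vector. -/
noncomputable def vectorFamily (M : Model Λ A B₁ B₂ C)
    (w : HTensor (HTensor A B₁) (HTensor B₂ C)) : Family :=
  fun a b c x z => ⟪w, M.globalEffect a b c x z w⟫_ℝ

/-- The observables of Alice on the global space. -/
noncomputable def aliceObs (M : Model Λ A B₁ B₂ C) (x : Fin 3) :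
    HTensor A (HTensor (HTensor B₁ B₂) C) →L[ℝ] HTensor A (HTensor (HTensor B₁ B₂) C) :=
  opLeft A (HTensor (HTensor B₁ B₂) C) (observable (M.alice x))

/-- Operators of Charlie on the global space. -/
noncomputable def onCharlie (A B₁ B₂ C : Type*)
    [NormedAddCommGroup A] [InnerProductSpace ℝ A]
    [NormedAddCommGroup B₁] [InnerProductSpace ℝ B₁]
    [NormedAddCommGroup B₂] [InnerProductSpace ℝ B₂]
    [NormedAddCommGroup C] [InnerProductSpace ℝ C] : (C →L[ℝ] C) →ₐ[ℝ]
    (HTensor A (HTensor (HTensor B₁ B₂) C) →L[ℝ] HTensor A (HTensor (HTensor B₁ B₂) C)) :=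
  (opRight A (HTensor (HTensor B₁ B₂) C)).comp (opRight (HTensor B₁ B₂) C)

/-- The observables of Charlie on the global space. -/
noncomputable def charlieObs (M : Model Λ A B₁ B₂ C) (z : Fin 6) :
    HTensor A (HTensor (HTensor B₁ B₂) C) →L[ℝ] HTensor A (HTensor (HTensor B₁ B₂) C) :=
  onCharlie A B₁ B₂ C (observable (M.charlie z))

/-- Operators of Bob on the global space. -/
noncomputable def onBob (A B₁ B₂ C : Type*)
    [NormedAddCommGroup A] [InnerProductSpace ℝ A]
    [NormedAddCommGroup B₁] [InnerProductSpace ℝ B₁]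
    [NormedAddCommGroup B₂] [InnerProductSpace ℝ B₂]
    [NormedAddCommGroup C] [InnerProductSpace ℝ C] :
    (HTensor B₁ B₂ →L[ℝ] HTensor B₁ B₂) →ₐ[ℝ]
    (HTensor A (HTensor (HTensor B₁ B₂) C) →L[ℝ] HTensor A (HTensor (HTensor B₁ B₂) C)) :=
  (opRight A (HTensor (HTensor B₁ B₂) C)).comp (opLeft (HTensor B₁ B₂) C)

/-- The projections of Bob on the global space. -/
noncomputable def bobProj (M : Model Λ A B₁ B₂ C) (b : Fin 2 × Fin 2) :
    HTensor A (HTensor (HTensor B₁ B₂) C) →L[ℝ] HTensor A (HTensor (HTensor B₁ B₂) C) :=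
  onBob A B₁ B₂ C (M.bob b)

variable (M : Model Λ A B₁ B₂ C)

theorem inner_aliceObs (x : Fin 3) (u v : HTensor A (HTensor (HTensor B₁ B₂) C)) :
    ⟪M.aliceObs x u, v⟫_ℝ = ⟪u, M.aliceObs x v⟫_ℝ :=
  inner_opLeft (inner_observable (M.alice_meas x)) u v

theorem aliceObs_mul_self (x : Fin 3) : M.aliceObs x * M.aliceObs x = 1 := by
  rw [aliceObs, ← map_mul, observable_mul_self (M.alice_meas x), map_one]

theorem inner_charlieObs (z : Fin 6) (u v : HTensor A (HTensor (HTensor B₁ B₂) C)) :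
    ⟪M.charlieObs z u, v⟫_ℝ = ⟪u, M.charlieObs z v⟫_ℝ :=
  inner_opRight (inner_opRight (inner_observable (M.charlie_meas z))) u v

theorem charlieObs_mul_self (z : Fin 6) : M.charlieObs z * M.charlieObs z = 1 := by
  rw [charlieObs, ← map_mul, observable_mul_self (M.charlie_meas z), map_one]

theorem inner_bobProj (b : Fin 2 × Fin 2) (u v : HTensor A (HTensor (HTensor B₁ B₂) C)) :
    ⟪M.bobProj b u, v⟫_ℝ = ⟪u, M.bobProj b v⟫_ℝ :=
  inner_opRight (inner_opLeft (inner_symm_of_isStarProjection (M.bob_meas.isProjection b))) u v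

theorem bobProj_mul_self (b : Fin 2 × Fin 2) : M.bobProj b * M.bobProj b = M.bobProj b := by
  rw [bobProj, ← map_mul, (M.bob_meas.isProjection b).isIdempotentElem.eq]

theorem sum_bobProj : ∑ b, M.bobProj b = 1 := by
  simp only [bobProj, ← map_sum, M.bob_meas.sum_eq_one, map_one]

theorem commute_aliceObs_onCharlie (x : Fin 3) (T : C →L[ℝ] C) :
    Commute (M.aliceObs x) (onCharlie A B₁ B₂ C T) :=
  commute_opLeft_opRight _ _

theorem commute_aliceObs_bobProj (x : Fin 3) (b : Fin 2 × Fin 2) :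
    Commute (M.aliceObs x) (M.bobProj b) :=
  commute_opLeft_opRight _ _

theorem commute_bobProj_onCharlie (b : Fin 2 × Fin 2) (T : C →L[ℝ] C) :
    Commute (M.bobProj b) (onCharlie A B₁ B₂ C T) :=
  (commute_opLeft_opRight _ _).map (opRight A (HTensor (HTensor B₁ B₂) C))

/-- Bob's projection is idempotent and commutes with the other parties, so it can be put on both
sides; correlators become expectations in the unnormalised vector after his outcome. -/
theorem corr_vectorFamily (w : HTensor (HTensor A B₁) (HTensor B₂ C)) (b : Fin 2 × Fin 2)
    (x : Fin 3) (z : Fin 6) :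
    corr (M.vectorFamily w) b x z =
      ⟪M.aliceObs x (M.bobProj b (shuffle A B₁ B₂ C w)),
        M.charlieObs z (M.bobProj b (shuffle A B₁ B₂ C w))⟫_ℝ := by
  set ψ := shuffle A B₁ B₂ C w with hψ
  have hop : opTensor (observable (M.alice x)) (opTensor (M.bob b) (observable (M.charlie z))) =
      M.bobProj b * (M.aliceObs x * (M.charlieObs z * M.bobProj b)) := by
    rw [opTensor_eq_mul, opTensor_eq_mul, map_mul]
    change M.aliceObs x * (M.bobProj b * M.charlieObs z) = _
    have hz : M.bobProj b * M.charlieObs z = M.charlieObs z * M.bobProj b :=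
      (M.commute_bobProj_onCharlie b _).eq
    rw [← hz, ← mul_assoc (M.bobProj b), ← (M.commute_aliceObs_bobProj x b).eq, mul_assoc,
      ← mul_assoc (M.bobProj b) (M.bobProj b), M.bobProj_mul_self]
  have hsum : corr (M.vectorFamily w) b x z =
      ⟪ψ, opTensor (observable (M.alice x))
        (opTensor (M.bob b) (observable (M.charlie z))) ψ⟫_ℝ := by
    rw [corr, Finset.sum_comm]
    simp only [vectorFamily, globalEffect, inner_pullback, ← hψ, ← opTensorₗ_apply,
      observable, map_sum, map_smul, LinearMap.sum_apply, LinearMap.smul_apply, sum_apply,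
      smul_apply, inner_sum, real_inner_smul_right, Finset.mul_sum]
    refine Finset.sum_congr rfl fun a _ => Finset.sum_congr rfl fun c _ => ?_
    ring
  rw [hsum, hop, inner_aliceObs]
  exact (M.inner_bobProj b _ _).symm

/-- The observables of Alice with the signs that Bob's outcome gives them. -/
noncomputable def signedObs (b : Fin 2 × Fin 2) : Fin 3 →
    HTensor A (HTensor (HTensor B₁ B₂) C) →L[ℝ] HTensor A (HTensor (HTensor B₁ B₂) C) :=
  ![(-1 : ℝ) ^ (b.2 : ℕ) • M.aliceObs 0, (-1 : ℝ) ^ (b.1 : ℕ) • M.aliceObs 1,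
    (-(-1 : ℝ) ^ ((b.1 : ℕ) + (b.2 : ℕ))) • M.aliceObs 2]

theorem exists_signedObs (b : Fin 2 × Fin 2) (x : Fin 3) :
    ∃ s : ℝ, s * s = 1 ∧ M.signedObs b x = s • M.aliceObs x := by
  have h : ∀ n : ℕ, (-1 : ℝ) ^ n * (-1 : ℝ) ^ n = 1 := fun n => by
    rw [← mul_pow]; norm_num
  fin_cases x
  · exact ⟨_, h _, rfl⟩
  · exact ⟨_, h _, rfl⟩
  · exact ⟨_, (neg_mul_neg _ _).trans (h _), rfl⟩

/-- The product of signs is independent of `b`, which lets one operator of Alice serve all four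
outcomes. -/
theorem exists_signs (b : Fin 2 × Fin 2) : ∃ s₀ s₁ s₂ : ℝ, M.signedObs b 0 = s₀ • M.aliceObs 0 ∧
    M.signedObs b 1 = s₁ • M.aliceObs 1 ∧ M.signedObs b 2 = s₂ • M.aliceObs 2 ∧
    s₀ * s₁ * s₂ = -1 := by
  refine ⟨_, _, _, rfl, rfl, rfl, ?_⟩
  have h : ∀ n : ℕ, (-1 : ℝ) ^ n * (-1 : ℝ) ^ n = 1 := fun n => by
    rw [← mul_pow]; norm_num
  rw [pow_add]
  linear_combination (-1 : ℝ) * (-1 : ℝ) ^ (b.2 : ℕ) * (-1 : ℝ) ^ (b.2 : ℕ) * h b.1 - h b.2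

theorem chshThree_vectorFamily (w : HTensor (HTensor A B₁) (HTensor B₂ C)) (b : Fin 2 × Fin 2) :
    chshThree (M.vectorFamily w) b =
      chshForm (M.signedObs b) M.charlieObs (M.bobProj b (shuffle A B₁ B₂ C w)) := by
  simp only [chshThree, chshForm, corr_vectorFamily, signedObs, Matrix.cons_val, smul_apply,
    real_inner_smul_left, inner_add_right, inner_sub_right]
  ring

/-- The difference of the triple product of Alice's observables and its transpose. -/
noncomputable def aliceSkew : A →L[ℝ] A :=
  observable (M.alice 0) * observable (M.alice 1) * observable (M.alice 2)
    - observable (M.alice 2) * observable (M.alice 1) * observable (M.alice 0)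

theorem inner_aliceSkew (x y : A) : ⟪M.aliceSkew x, y⟫_ℝ = ⟪x, (-M.aliceSkew) y⟫_ℝ := by
  simp only [aliceSkew, neg_sub, sub_apply, mul_apply_eq_comp, inner_sub_left,
    inner_sub_right, inner_observable (M.alice_meas _)]

/-- The minus sign is the product of the three signs. Bob's projection commutes with the operator,
so it is kept on one side of the inner product only; the right side is then linear in it and sums
over `b`. -/
theorem norm_sq_sub_le_neg_inner (w : HTensor (HTensor A B₁) (HTensor B₂ C))
    (b : Fin 2 × Fin 2) :
    ‖M.bobProj b (shuffle A B₁ B₂ C w)‖ ^ 2 - 400 * √2 *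
        (6 * √2 * ‖M.bobProj b (shuffle A B₁ B₂ C w)‖ ^ 2 - chshThree (M.vectorFamily w) b) ≤
      -⟪shuffle A B₁ B₂ C w, (opTensor M.aliceSkew
        (opTensor 1 (tripleOp fun z => observable (M.charlie z))))
          (M.bobProj b (shuffle A B₁ B₂ C w))⟫_ℝ := by
  set φ := M.bobProj b (shuffle A B₁ B₂ C w) with hφ
  have hs : ∀ x u v, ⟪M.signedObs b x u, v⟫_ℝ = ⟪u, M.signedObs b x v⟫_ℝ := by
    intro x u v
    obtain ⟨s, -, h⟩ := M.exists_signedObs b x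
    rw [h, smul_apply, smul_apply, real_inner_smul_left, real_inner_smul_right, inner_aliceObs]
  have h2 : ∀ x u, M.signedObs b x (M.signedObs b x u) = u := by
    intro x u
    obtain ⟨s, hs, h⟩ := M.exists_signedObs b x
    rw [h, smul_apply, smul_apply, map_smul, smul_smul, hs, one_smul]
    exact congrArg (fun F => F u) (M.aliceObs_mul_self x)
  have hC2 : ∀ z u, M.charlieObs z (M.charlieObs z u) = u := fun z u =>
    congrArg (fun F => F u) (M.charlieObs_mul_self z)
  have hAC : ∀ x z u, M.signedObs b x (M.charlieObs z u) = M.charlieObs z (M.signedObs b x u) := by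
    intro x z u
    obtain ⟨s, -, h⟩ := M.exists_signedObs b x
    rw [h, smul_apply, smul_apply, map_smul]
    exact congrArg (fun F => s • F u) (M.commute_aliceObs_onCharlie x _).eq
  have main := norm_sq_sub_le_inner_tripleOp
    (fun x => norm_apply_eq_of_involution (hs x) (h2 x)) hs
    (fun z => norm_apply_eq_of_involution (M.inner_charlieObs z) (hC2 z)) hC2 hAC φ
  rw [← chshThree_vectorFamily] at main
  refine main.trans (le_of_eq ?_)
  set Y := opTensor M.aliceSkew (opTensor (1 : HTensor B₁ B₂ →L[ℝ] HTensor B₁ B₂)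
    (tripleOp fun z => observable (M.charlie z))) with hY
  have e : tripleOp M.charlieObs =
      onCharlie A B₁ B₂ C (tripleOp fun z => observable (M.charlie z)) :=
    (map_tripleOp _ _).symm
  have hYmul : Y = (M.aliceObs 0 * M.aliceObs 1 * M.aliceObs 2
      - M.aliceObs 2 * M.aliceObs 1 * M.aliceObs 0) * tripleOp M.charlieObs := by
    rw [hY, opTensor_eq_mul, e]
    simp only [aliceSkew, aliceObs, map_sub, map_mul]
    rfl
  have hYB : Commute (M.bobProj b) Y := by
    have hA : ∀ x, Commute (M.bobProj b) (M.aliceObs x) := fun x =>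
      (M.commute_aliceObs_bobProj x b).symm
    rw [hYmul, e]
    exact ((((hA 0).mul_right (hA 1)).mul_right (hA 2)).sub_right
      (((hA 2).mul_right (hA 1)).mul_right (hA 0))).mul_right (M.commute_bobProj_onCharlie b _)
  have hφφ : M.bobProj b φ = φ :=
    congrArg (fun F => F (shuffle A B₁ B₂ C w)) (M.bobProj_mul_self b)
  have hinner : ⟪shuffle A B₁ B₂ C w, Y φ⟫_ℝ = ⟪φ, Y φ⟫_ℝ := by
    have h1 : Y φ = M.bobProj b (Y φ) := by
      conv_lhs => rw [← hφφ]
      exact (congrArg (fun F => F φ) hYB.eq).symm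
    rw [h1, ← M.inner_bobProj, ← hφ, ← h1]
  obtain ⟨s₀, s₁, s₂, h₀, h₁, h₂, hsign⟩ := M.exists_signs b
  rw [hinner, hYmul, ← inner_neg_right, h₀, h₁, h₂]
  congr 1
  simp only [smul_apply, map_smul, mul_apply_eq_comp, sub_apply]
  linear_combination (norm := module) hsign • (M.aliceObs 0 (M.aliceObs 1 (M.aliceObs 2
    (tripleOp M.charlieObs φ))) - M.aliceObs 2 (M.aliceObs 1 (M.aliceObs 0
    (tripleOp M.charlieObs φ))))

/-- Independence of the sources and reality enter here: the expectation factors over `e` and `f`,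
and symmetry of the real inner product makes the factor at `e` equal to its own negative. -/
theorem inner_opTensor_aliceSkew (e : HTensor A B₁) (f : HTensor B₂ C) (T : C →L[ℝ] C) :
    ⟪shuffle A B₁ B₂ C (tmk e f), opTensor M.aliceSkew (opTensor 1 T)
      (shuffle A B₁ B₂ C (tmk e f))⟫_ℝ = 0 := by
  have h := shuffle_opTensor M.aliceSkew (1 : B₁ →L[ℝ] B₁) (1 : B₂ →L[ℝ] B₂) T (tmk e f)
  rw [opTensor_one] at h
  rw [← h, LinearIsometryEquiv.inner_map_map, opTensor_tmk, inner_tmk]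
  have h0 : ⟪opLeft A B₁ M.aliceSkew e, e⟫_ℝ = ⟪e, opLeft A B₁ (-M.aliceSkew) e⟫_ℝ :=
    inner_opLeft M.inner_aliceSkew e e
  rw [map_neg, neg_apply, inner_neg_right, real_inner_comm, opLeft_apply] at h0
  rw [self_eq_neg.mp h0, zero_mul]

/-- On product vectors, the sum of the three CHSH expressions stays away from the maximal quantum
value. -/
theorem norm_sq_le_of_product (e : HTensor A B₁) (f : HTensor B₂ C) :
    ‖tmk e f‖ ^ 2 ≤ 400 * √2 *
      (6 * √2 * ‖tmk e f‖ ^ 2 - ∑ b, chshThree (M.vectorFamily (tmk e f)) b) := by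
  have h := Finset.sum_le_sum fun b (_ : b ∈ Finset.univ) =>
    M.norm_sq_sub_le_neg_inner (tmk e f) b
  have hone : ∑ b, M.bobProj b (shuffle A B₁ B₂ C (tmk e f)) = shuffle A B₁ B₂ C (tmk e f) := by
    rw [← sum_apply, sum_bobProj, one_apply_eq_self]
  have hnorm : ∑ b, ‖M.bobProj b (shuffle A B₁ B₂ C (tmk e f))‖ ^ 2 = ‖tmk e f‖ ^ 2 := by
    have hb : ∀ b u, ‖M.bobProj b u‖ ^ 2 = ⟪u, M.bobProj b u⟫_ℝ := fun b u => by
      rw [← real_inner_self_eq_norm_sq, inner_bobProj]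
      exact congrArg (fun F => ⟪u, F u⟫_ℝ) (M.bobProj_mul_self b)
    simp only [hb]
    rw [← inner_sum, hone, real_inner_self_eq_norm_sq, LinearIsometryEquiv.norm_map]
  -- Since Bob's projections add up to the identity, the right side becomes the expectation that
  -- vanishes.
  rw [Finset.sum_neg_distrib, ← inner_sum, ← map_sum, hone, inner_opTensor_aliceSkew, neg_zero,
    Finset.sum_sub_distrib, ← Finset.mul_sum, Finset.sum_sub_distrib, ← Finset.mul_sum, hnorm] at h
  linarith

/-- The bound on the functional for product vectors. -/
theorem sum_chshThree_vectorFamily_le {e : HTensor A B₁} {f : HTensor B₂ C} (he : ‖e‖ = 1)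
    (hf : ‖f‖ = 1) :
    ∑ b, chshThree (M.vectorFamily (tmk e f)) b ≤ 6 * √2 - criticalError := by
  have h := M.norm_sq_le_of_product e f
  rw [norm_tmk, he, hf] at h
  have h2 : √2 ≤ 3 / 2 := Real.sqrt_le_iff.mpr ⟨by norm_num, by norm_num⟩
  have h0 : (0 : ℝ) < √2 := by positivity
  -- With `√2 ≤ 3/2` the left side is at most `600 * 7.18e-5 < 0.05`.
  have hc : 400 * √2 * criticalError ≤ 1 := by
    rw [criticalError]; linarith
  by_contra! hlt
  have := mul_lt_mul_of_pos_left hlt (by positivity : (0 : ℝ) < 400 * √2)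
  linarith

/-- A pair of states, diagonalised in product vectors, obeys the bound for product vectors. -/
theorem sum_chshThree_le_of_hasTrace (l : Λ) {Q : Family}
    (hQ : ∀ a b c x z, HasTrace (M.globalState l ∘L M.globalEffect a b c x z) (Q a b c x z)) :
    ∑ b, chshThree Q b ≤ 6 * √2 - criticalError := by
  obtain ⟨ι, e, s, he, hs0, hs1⟩ := (M.σ_state l).exists_eigenbasis
  obtain ⟨κ, f, t, hf, ht0, ht1⟩ := (M.τ_state l).exists_eigenbasis
  obtain ⟨B, hB⟩ := exists_hilbertBasis_tmk e f
  have hw1 : HasSum (fun i : ι × κ => s i.1 * t i.2) 1 := by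
    have h := hs1.summable.mul_of_nonneg ht1.summable hs0 ht0
    have := hs1.mul ht1 h
    rwa [one_mul] at this
  refine sum_chshThree_le_of_mixture (w := fun i : ι × κ => s i.1 * t i.2)
    (F := fun i => M.vectorFamily (tmk (e i.1) (f i.2)))
    (fun i => mul_nonneg (hs0 _) (ht0 _)) hw1 (fun a b c x z => ?_)
    (fun i => M.sum_chshThree_vectorFamily_le (e.orthonormal.1 _) (f.orthonormal.1 _))
  have h := (hQ a b c x z).hasSum B
  -- Moved to the left by symmetry, `σ ⊗ τ` multiplies the basis vector by the product of
  -- eigenvalues, which is its weight in the mixture.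
  refine h.congr_fun fun i => ?_
  rw [ContinuousLinearMap.comp_apply, globalState, hB, vectorFamily,
    ← inner_opTensor (fun x y => (M.σ_state l).isPositive.inner_left_eq_inner_right x y)
      (fun x y => (M.τ_state l).isPositive.inner_left_eq_inner_right x y),
    opTensor_tmk, he, hf, tmk_smul_left, tmk_smul_right, smul_smul, real_inner_smul_left]

/-- The real bound: models on real Hilbert spaces stay away from the maximal quantum value. -/
theorem Reproduces.sum_chshThree_le {M : Model Λ A B₁ B₂ C} {P : Family} (h : M.Reproduces P) :
    ∑ b, chshThree P b ≤ 6 * √2 - criticalError := by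
  choose t ht hP using h
  exact sum_chshThree_le_of_mixture (F := fun l a b c x z => t a b c x z l) M.p_nonneg M.p_sum hP
    fun l => M.sum_chshThree_le_of_hasTrace l fun a b c x z => ht a b c x z l

end Model

end RealSwap

theorem theorem2 (P : RealSwap.Family) (hP : RealSwap.IsDistribution P)
    (p : Fin 2 × Fin 2 → ℝ) (hp : RealSwap.IsBobMarginal P p)
    (hprob : ∀ b, |p b - 1 / 4| < RealSwap.criticalError)
    (hchsh : ∀ b, RealSwap.chshThree P b
      > (6 * Real.sqrt 2 - RealSwap.criticalError) * p b) :
    ¬ RealSwap.HasRealQuantumRepresentation.{u₀, u₁, u₂, u₃, u₄} P := by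
  rintro ⟨Λ, A, _, _, _, B₁, _, _, _, B₂, _, _, _, C, _, _, _, M, hM⟩
  have hsum : ∑ b, p b = 1 := by
    rw [← hP.sum_eq_one 0 0, Finset.sum_comm]
    exact Finset.sum_congr rfl fun b _ => (hp b 0 0).symm
  -- As the `p b` add up to 1, the sum of the four inequalities strictly exceeds the real bound.
  have hlt := Finset.sum_lt_sum_of_nonempty (s := Finset.univ) Finset.univ_nonempty
    fun b _ => hchsh b
  rw [← Finset.mul_sum, hsum, mul_one] at hlt
  exact absurd hM.sum_chshThree_le (not_le.mpr hlt)
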